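/- For a natural number $k\ge 1$ let $d(k)$ denote the number of positive divisors of $k$, and let $\gamma=0.57721\ldots$ be Euler's constant. For every real number $q$ with $0<q<1$ the series $\sum_{k=1}^\infty (d(k+1)-d(k))\,q^k$ converges and $$ \alpha_0+\frac{(1-q)\log(1-q)}{q\log(q)} <\sum_{k=1}^\infty \bigl(d(k+1)-d(k)\bigr)\,q^k <\beta_0+\frac{(1-q)\log(1-q)}{q\log(q)} $$ with $\alpha_0=\gamma-1$ and $\beta_0=0$. These constants are best possible: if a real number $\alpha$ is such that the left-hand inequality with $\alpha$ in place of $\alpha_0$ holds for all $q\in(0,1)$, then $\alpha\le\gamma-1$; and if a real number $\beta$ is such that the right-hand inequality with $\beta$ in place of $\beta_0$ holds for all $q\in(0,1)$, then $\beta\ge 0$. -/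

import Mathlib

/-- `numDiv k` is the number `d(k)` of positive divisors of `k` (for `k ≥ 1`), as a real number. -/
def numDiv (k : ℕ) : ℝ := ((Nat.divisors k).card : ℝ)

open Filter Topology Finset

/-! Put q = exp(-t) and S = ∑ `bose t n` over n ≥ 1. Lambert's identity gives ∑ d(k) q^k = S, and
the claim becomes γ < (S + `boseInt t 1`) / `bose t 1` < 1. The numerator is the sum of the defects
`bose t n` - ∫ `bose t` over [n, n+1]. As `bose t` decreases, each defect is less than a telescoping
difference, which yields the bound 1. For γ, compare with 1/x, whose defects sum to γ. `bose t` is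
convex as a function of 1/x, so `boseInt_sub_le` bounds each defect below by `invMean n` times the
drop of `bose t` from n to n+1, with equality for 1/x. The weights `invMean n` decrease and `bose t
x ≤ bose t 1 / x`, so Abel summation compares the two sums (`euler_mul_bose_lt`). The ratio tends to
γ as t → 0 and to 1 as t → ∞, so both constants are sharp. -/

/-- The Bose function `x ↦ 1 / (exp (t x) - 1)`. -/
noncomputable def bose (t x : ℝ) : ℝ := 1 / (Real.exp (t * x) - 1)

/-- An antiderivative of `bose t`, vanishing at infinity. -/
noncomputable def boseInt (t x : ℝ) : ℝ := Real.log (1 - Real.exp (-(t * x))) / t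

/-- The mean of `y ↦ (1 / a - 1 / y) / (1 / a - 1 / (a + 1))` over `[a, a + 1]`. -/
noncomputable def invMean (a : ℝ) : ℝ := (a + 1) - a * (a + 1) * Real.log (1 + 1 / a)

variable {t : ℝ}

lemma exp_sub_one_pos (ht : 0 < t) {x : ℝ} (hx : 0 < x) : 0 < Real.exp (t * x) - 1 :=
  sub_pos.2 (Real.one_lt_exp_iff.2 (mul_pos ht hx))

lemma bose_pos (ht : 0 < t) {x : ℝ} (hx : 0 < x) : 0 < bose t x :=
  one_div_pos.2 (exp_sub_one_pos ht hx)

lemma bose_lt_bose (ht : 0 < t) {x y : ℝ} (hx : 0 < x) (hxy : x < y) : bose t y < bose t x := by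
  unfold bose
  refine one_div_lt_one_div_of_lt (exp_sub_one_pos ht hx) ?_
  gcongr

lemma hasDerivAt_boseInt (ht : 0 < t) {x : ℝ} (hx : 0 < x) :
    HasDerivAt (boseInt t) (bose t x) x := by
  have h0 := exp_sub_one_pos ht hx
  have h1 : 0 < 1 - Real.exp (-(t * x)) :=
    sub_pos.2 (Real.exp_lt_one_iff.2 (neg_lt_zero.2 (mul_pos ht hx)))
  have h2 : HasDerivAt (fun x : ℝ => -(t * x)) (-t) x := by
    exact ((hasDerivAt_id x).const_mul t).neg.congr_deriv (by simp)
  have h3 := ((h2.exp.const_sub 1).log h1.ne').div_const t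
  refine HasDerivAt.congr_deriv (f := boseInt t) h3 ?_
  have h4 : Real.exp (t * x) * Real.exp (-(t * x)) = 1 := by rw [← Real.exp_add]; simp
  unfold bose
  field_simp
  linear_combination h4

lemma exists_bose_eq_boseInt_sub (ht : 0 < t) {a : ℝ} (ha : 0 < a) :
    ∃ c ∈ Set.Ioo a (a + 1), bose t c = boseInt t (a + 1) - boseInt t a := by
  obtain ⟨c, hc, h⟩ := exists_hasDerivAt_eq_slope (boseInt t) (bose t) (lt_add_one a)
    (fun x hx => (hasDerivAt_boseInt ht (ha.trans_le hx.1)).continuousAt.continuousWithinAt)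
    (fun x hx => hasDerivAt_boseInt ht (ha.trans hx.1))
  exact ⟨c, hc, by simpa using h⟩

lemma bose_lt_boseInt_sub (ht : 0 < t) {a : ℝ} (ha : 0 < a) :
    bose t (a + 1) < boseInt t (a + 1) - boseInt t a := by
  obtain ⟨c, hc, h⟩ := exists_bose_eq_boseInt_sub ht ha
  exact h ▸ bose_lt_bose ht (ha.trans hc.1) hc.2

/-! ### Convexity of the Bose function in the variable 1/x. -/

/-- Monotonicity of sinh(v)/v, by termwise comparison of power series. -/
lemma sinh_mul_le_sinh_mul {v w : ℝ} (hv : 0 ≤ v) (hvw : v ≤ w) :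
    Real.sinh v * w ≤ Real.sinh w * v := by
  refine hasSum_le (fun n => ?_) ((Real.hasSum_sinh v).mul_right w)
    ((Real.hasSum_sinh w).mul_right v)
  have hw := hv.trans hvw
  have : v ^ (2 * n) ≤ w ^ (2 * n) := by gcongr
  rw [div_mul_eq_mul_div, div_mul_eq_mul_div, pow_succ, pow_succ]
  have := mul_le_mul_of_nonneg_right this (mul_nonneg hv hw)
  gcongr ?_ / _
  linarith

lemma exp_sub_one_eq_sinh (u : ℝ) :
    Real.exp u - 1 = 2 * Real.exp (u / 2) * Real.sinh (u / 2) := by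
  have h1 : Real.exp u = Real.exp (u / 2) * Real.exp (u / 2) := by rw [← Real.exp_add]; ring_nf
  have h2 : Real.exp (u / 2) * Real.exp (-(u / 2)) = 1 := by rw [← Real.exp_add]; simp
  rw [Real.sinh_eq, h1]
  linear_combination h2

/-- Written through v / sinh v with v = t/(2y), so that the derivative visibly increases with y. -/
lemma hasDerivAt_bose_inv (ht : 0 < t) {y : ℝ} (hy : 0 < y) :
    HasDerivAt (fun y => bose t y⁻¹)
      (1 / t * ((t / y / 2) / Real.sinh (t / y / 2)) ^ 2) y := by
  have h0 := exp_sub_one_pos ht (inv_pos.2 hy)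
  have h2 := ((((hasDerivAt_inv hy.ne').const_mul t).exp.sub_const 1).inv h0.ne')
  have hs : 0 < Real.sinh (t / y / 2) := Real.sinh_pos_iff.2 (by positivity)
  have h3 : Real.exp (t * y⁻¹) = Real.exp (t / y / 2) ^ 2 := by
    rw [← Real.exp_nat_mul]; congr 1; push_cast; field_simp
  have h4 : (fun y => bose t y⁻¹) = (fun y => Real.exp (t * y⁻¹) - 1)⁻¹ := by
    ext z; simp [bose]
  rw [h4]
  refine h2.congr_deriv ?_
  have h5 : t * y⁻¹ / 2 = t / y / 2 := by rw [div_eq_mul_inv t]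
  rw [exp_sub_one_eq_sinh, h3, h5]
  field_simp

lemma convexOn_bose_inv (ht : 0 < t) : ConvexOn ℝ (Set.Ioi 0) (fun y => bose t y⁻¹) := by
  refine MonotoneOn.convexOn_of_deriv (convex_Ioi 0)
    (fun y hy => (hasDerivAt_bose_inv ht hy).continuousAt.continuousWithinAt) ?_ ?_ <;>
    rw [interior_Ioi]
  · exact fun y hy => (hasDerivAt_bose_inv ht hy).differentiableAt.differentiableWithinAt
  · intro y hy z hz hyz
    have hy' : 0 < y := hy
    have hz' : 0 < z := hz
    rw [(hasDerivAt_bose_inv ht hy).deriv, (hasDerivAt_bose_inv ht hz).deriv]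
    have hsy : 0 < Real.sinh (t / y / 2) := Real.sinh_pos_iff.2 (by positivity)
    have hsz : 0 < Real.sinh (t / z / 2) := Real.sinh_pos_iff.2 (by positivity)
    have h : t / z / 2 ≤ t / y / 2 := by gcongr
    gcongr 1 / t * ?_ ^ 2
    rw [div_le_div_iff₀ hsy hsz]
    have := sinh_mul_le_sinh_mul (by positivity) h
    linarith

lemma bose_le_chord (ht : 0 < t) {a x : ℝ} (ha : 0 < a) (hx : a ≤ x) (hx' : x ≤ a + 1) :
    bose t x ≤ bose t (a + 1) + (bose t a - bose t (a + 1)) * (a * (a + 1) * x⁻¹ - a) := by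
  have hx0 : 0 < x := ha.trans_le hx
  have h := (convexOn_bose_inv ht).2 (Set.mem_Ioi.2 (inv_pos.2 ha))
    (Set.mem_Ioi.2 (inv_pos.2 (by positivity : 0 < a + 1)))
    (div_nonneg (mul_nonneg ha.le (sub_nonneg.2 hx')) hx0.le)
    (div_nonneg (mul_nonneg (by positivity : 0 ≤ a + 1) (sub_nonneg.2 hx)) hx0.le) (by field_simp; ring)
  have e : (a * (a + 1 - x) / x) • a⁻¹ + ((a + 1) * (x - a) / x) • (a + 1)⁻¹ = x⁻¹ := by
    simp only [smul_eq_mul]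
    field_simp
    ring
  rw [e] at h
  simp only [inv_inv, smul_eq_mul] at h
  refine h.trans_eq ?_
  field_simp
  ring

/-- The integral of `bose_le_chord` over [a, a+1]. -/
lemma boseInt_sub_le (ht : 0 < t) {a : ℝ} (ha : 0 < a) :
    boseInt t (a + 1) - boseInt t a
      ≤ bose t a - invMean a * (bose t a - bose t (a + 1)) := by
  set Δ := bose t a - bose t (a + 1) with hΔ
  have hd : ∀ x, a ≤ x → HasDerivAt (fun x => bose t (a + 1) * x
      + Δ * (a * (a + 1) * Real.log x - a * x) - boseInt t x)
      (bose t (a + 1) + Δ * (a * (a + 1) * x⁻¹ - a) - bose t x) x := by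
    intro x hx
    have hx0 : 0 < x := ha.trans_le hx
    have h1 := (hasDerivAt_id x).const_mul (bose t (a + 1))
    have h2 := (hasDerivAt_id x).const_mul a
    have h3 := (Real.hasDerivAt_log hx0.ne').const_mul (a * (a + 1))
    exact ((h1.add ((h3.sub h2).const_mul Δ)).sub (hasDerivAt_boseInt ht hx0)).congr_deriv
      (by simp)
  have hm := monotoneOn_of_deriv_nonneg (convex_Icc a (a + 1))
    (fun x hx => (hd x hx.1).continuousAt.continuousWithinAt)
    (by
      rw [interior_Icc]
      exact fun x hx => (hd x hx.1.le).differentiableAt.differentiableWithinAt)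
    (by
      rw [interior_Icc]
      intro x hx
      rw [(hd x hx.1.le).deriv]
      exact sub_nonneg.2 (bose_le_chord ht ha hx.1.le hx.2.le))
  have h := hm (Set.left_mem_Icc.2 (by linarith)) (Set.right_mem_Icc.2 (by linarith))
    (by linarith : a ≤ a + 1)
  have hl : Real.log (1 + 1 / a) = Real.log (a + 1) - Real.log a := by
    rw [← Real.log_div (by positivity) ha.ne']; congr 1; field_simp
  simp only at h
  rw [invMean, hl]
  linear_combination h + hΔ

/-! ### Ingredients of the Abel summation. -/

lemma invMean_nonneg {a : ℝ} (ha : 0 < a) : 0 ≤ invMean a := by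
  have h := Real.log_le_sub_one_of_pos (by positivity : 0 < 1 + 1 / a)
  have h2 := mul_le_mul_of_nonneg_left h (by positivity : 0 ≤ a * (a + 1))
  have e : a * (a + 1) * (1 + 1 / a - 1) = a + 1 := by field_simp; ring
  unfold invMean
  linarith

lemma invMean_lt {a b : ℝ} (ha : 0 < a) (hab : a < b) : invMean b < invMean a := by
  have hd : ∀ x : ℝ, 0 < x →
      HasDerivAt invMean (2 - (2 * x + 1) * Real.log (1 + 1 / x)) x := by
    intro x hx
    have h1 := (hasDerivAt_id x).add_const (1 : ℝ)
    have h2 := (hasDerivAt_id x).mul h1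
    have h3 := ((hasDerivAt_inv hx.ne').const_add 1).log (by positivity : 1 + x⁻¹ ≠ 0)
    have h4 := h1.sub (h2.mul h3)
    have h5 : invMean = (fun x => id x + 1) - (id * fun x => id x + 1) * fun y =>
        Real.log (1 + y⁻¹) := by
      ext y; simp [invMean]
    rw [h5]
    refine h4.congr_deriv ?_
    simp only [Pi.mul_apply, id, one_div]
    field_simp
    ring
  have hm : StrictAntiOn invMean (Set.Ioi 0) := by
    refine strictAntiOn_of_deriv_neg (convex_Ioi 0)
      (fun x hx => (hd x hx).continuousAt.continuousWithinAt) ?_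
    rw [interior_Ioi]
    intro x hx
    have hx' : 0 < x := hx
    rw [(hd x hx).deriv]
    -- log(1+u) > 2u/(u+2) at u = 1/x is exactly negativity of the derivative.
    have h := Real.lt_log_one_add_of_pos (one_div_pos.2 hx')
    have h2 := mul_lt_mul_of_pos_left h (by positivity : 0 < 2 * x + 1)
    have e : (2 * x + 1) * (2 * (1 / x) / (1 / x + 2)) = 2 := by field_simp; ring
    linarith
  exact hm ha (ha.trans hab) hab

/-- Bernoulli's inequality for (exp t)^x. -/
lemma bose_le_div (ht : 0 < t) {x : ℝ} (hx : 1 ≤ x) : bose t x ≤ bose t 1 / x := by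
  have h := one_add_mul_self_le_rpow_one_add
    (by linarith [exp_sub_one_pos ht one_pos] : -1 ≤ Real.exp (t * 1) - 1) hx
  rw [add_sub_cancel, ← Real.exp_mul, mul_one] at h
  have := exp_sub_one_pos ht one_pos
  rw [bose, bose, div_div]
  refine one_div_le_one_div_of_le (by positivity) ?_
  simp only [mul_one]
  linarith

lemma bose_lt_div (ht : 0 < t) {x : ℝ} (hx : 1 < x) : bose t x < bose t 1 / x := by
  have hp := exp_sub_one_pos ht one_pos
  have h := one_add_mul_self_lt_rpow_one_add (by linarith : -1 ≤ Real.exp (t * 1) - 1) hp.ne' hx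
  rw [add_sub_cancel, ← Real.exp_mul, mul_one] at h
  rw [bose, bose, div_div]
  refine one_div_lt_one_div_of_lt (by positivity) ?_
  simp only [mul_one]
  linarith

/-- The first Abel term is kept, not just its sign: a bound independent of N keeps the inequality
strict in the limit. -/
lemma abel_lower_bound {e w : ℕ → ℝ} (he : Antitone e) (he0 : ∀ n, 0 ≤ e n)
    (hw : ∀ n, 0 ≤ ∑ i ∈ range n, w i) (N : ℕ) :
    (e 0 - e 1) * w 0 ≤ ∑ i ∈ range (N + 2), e i * w i := by
  have key : ∀ N, e (N + 1) * (∑ i ∈ range (N + 2), w i) + (e 0 - e 1) * w 0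
      ≤ ∑ i ∈ range (N + 2), e i * w i := by
    intro N
    induction N with
    | zero => simp [sum_range_succ]; linarith
    | succ N ih =>
      rw [sum_range_succ w (N + 2), sum_range_succ _ (N + 2)]
      have := mul_le_mul_of_nonneg_right (he (N + 1).le_succ) (hw (N + 2))
      simp only [Nat.succ_eq_add_one] at this
      linarith
  linarith [key N, mul_nonneg (he0 (N + 1)) (hw (N + 2))]

/-! ### The Lambert series as a sum of defects, and the two bounds. -/

lemma tendsto_boseInt_atTop (ht : 0 < t) :
    Tendsto (fun n : ℕ => boseInt t (n + 1)) atTop (𝓝 0) := by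
  have h1 : Tendsto (fun n : ℕ => t * ((n : ℝ) + 1)) atTop atTop :=
    (tendsto_atTop_add_const_right _ _ tendsto_natCast_atTop_atTop).const_mul_atTop ht
  have h2 := (Real.tendsto_exp_neg_atTop_nhds_zero.comp h1).const_sub 1
  have h3 := (h2.log (by norm_num)).div_const t
  simpa [boseInt] using h3

lemma summable_bose (ht : 0 < t) : Summable (fun n : ℕ => bose t (n + 1)) := by
  rw [← summable_nat_add_iff 1]
  refine summable_of_sum_range_le (c := -boseInt t 1)
    (fun n => (bose_pos ht (by positivity)).le) fun N => ?_
  have h : ∀ M : ℕ, ∑ i ∈ range M, bose t ((i + 1 : ℕ) + 1) ≤ boseInt t (M + 1) - boseInt t 1 := by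
    intro M
    induction M with
    | zero => simp
    | succ M ih =>
      rw [sum_range_succ]
      have := bose_lt_boseInt_sub ht (a := (M : ℝ) + 1) (by positivity)
      push_cast at *
      linarith
  refine (h N).trans ?_
  have : boseInt t (N + 1) ≤ 0 := by
    refine div_nonpos_of_nonpos_of_nonneg (Real.log_nonpos ?_ ?_) ht.le
    · rw [sub_nonneg, Real.exp_le_one_iff, neg_nonpos]; positivity
    · linarith [Real.exp_pos (-(t * (N + 1 : ℝ)))]
  linarith

/-- The difference between the `n`-th term of the Lambert series and the integral of `bose t`
over the unit interval to its right. -/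
noncomputable def boseDefect (t : ℝ) (n : ℕ) : ℝ :=
  bose t (n + 1) - (boseInt t (n + 1 + 1) - boseInt t (n + 1))

lemma sum_boseDefect (N : ℕ) :
    ∑ i ∈ range N, boseDefect t i
      = ∑ i ∈ range N, bose t (i + 1) - (boseInt t (N + 1) - boseInt t 1) := by
  have := sum_range_sub (fun i : ℕ => boseInt t (i + 1)) N
  simp only [boseDefect, sum_sub_distrib] at *
  push_cast at this
  rw [zero_add] at this
  linarith

lemma tendsto_sum_boseDefect (ht : 0 < t) :
    Tendsto (fun N => ∑ i ∈ range N, boseDefect t i) atTop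
      (𝓝 (∑' n : ℕ, bose t (n + 1) + boseInt t 1)) := by
  simp_rw [sum_boseDefect]
  simpa using (summable_bose ht).hasSum.tendsto_sum_nat.sub
    ((tendsto_boseInt_atTop ht).sub_const (boseInt t 1))

lemma boseDefect_lt (ht : 0 < t) (n : ℕ) :
    boseDefect t n < bose t (n + 1) - bose t (n + 1 + 1) := by
  have := bose_lt_boseInt_sub ht (a := (n : ℝ) + 1) (by positivity)
  unfold boseDefect
  linarith

lemma le_boseDefect (ht : 0 < t) (n : ℕ) :
    invMean (n + 1) * (bose t (n + 1) - bose t (n + 1 + 1)) ≤ boseDefect t n := by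
  have := boseInt_sub_le ht (a := (n : ℝ) + 1) (by positivity)
  unfold boseDefect
  linarith

lemma invMean_mul (n : ℕ) :
    invMean (n + 1) * (1 / ((n : ℝ) + 1) - 1 / (n + 1 + 1))
      = 1 / ((n : ℝ) + 1) - (Real.log (n + 1 + 1) - Real.log (n + 1)) := by
  have hl : Real.log (1 + 1 / ((n : ℝ) + 1)) = Real.log (n + 1 + 1) - Real.log (n + 1) := by
    rw [← Real.log_div (by positivity) (by positivity)]; congr 1; field_simp
  rw [invMean, hl]
  field_simp
  ring

lemma eulerMascheroniSeq_eq_sum (N : ℕ) :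
    Real.eulerMascheroniSeq N = ∑ i ∈ range N, 1 / ((i : ℝ) + 1) - Real.log (N + 1) := by
  simp [Real.eulerMascheroniSeq, harmonic]

lemma sum_invMean_mul (N : ℕ) :
    ∑ i ∈ range N, invMean (i + 1) * (1 / ((i : ℝ) + 1) - 1 / (i + 1 + 1))
      = Real.eulerMascheroniSeq N := by
  have := sum_range_sub (fun i : ℕ => Real.log ((i : ℝ) + 1)) N
  push_cast at this
  simp only [invMean_mul, eulerMascheroniSeq_eq_sum, sum_sub_distrib] at *
  simp at *
  linarith

lemma euler_mul_bose_lt (ht : 0 < t) :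
    Real.eulerMascheroniConstant * bose t 1 < ∑' n : ℕ, bose t (n + 1) + boseInt t 1 := by
  set w : ℕ → ℝ := fun n => (bose t (n + 1) - bose t (n + 1 + 1))
    - bose t 1 * (1 / ((n : ℝ) + 1) - 1 / (n + 1 + 1)) with hw
  set e : ℕ → ℝ := fun n => invMean (n + 1) with he
  have hsum : ∀ N, ∑ i ∈ range N, w i = bose t 1 / (N + 1) - bose t (N + 1) := by
    intro N
    induction N with
    | zero => simp
    | succ N ih =>
      rw [sum_range_succ, ih, hw]
      push_cast
      field_simp
      ring
  have hanti : StrictAnti e := strictAnti_nat_of_succ_lt fun n => by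
    have := invMean_lt (a := (n : ℝ) + 1) (b := (n : ℝ) + 1 + 1) (by positivity) (by linarith)
    simpa [he] using this
  have hδ : 0 < (e 0 - e 1) * w 0 := by
    refine mul_pos (sub_pos.2 (hanti one_pos)) ?_
    have h1 := hsum 1
    have h2 := bose_lt_div ht (x := 1 + 1) (by norm_num)
    simp at h1
    rw [h1]
    linarith
  have hN : ∀ N : ℕ, bose t 1 * Real.eulerMascheroniSeq (N + 2) + (e 0 - e 1) * w 0
      ≤ ∑ i ∈ range (N + 2), boseDefect t i := by
    intro N
    have h1 := abel_lower_bound hanti.antitone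
      (fun n => invMean_nonneg (by positivity : (0 : ℝ) < n + 1))
      (w := w) (fun n => by
        rw [hsum]; exact sub_nonneg.2 (bose_le_div ht (by simp))) N
    have h2 := sum_le_sum fun i (_ : i ∈ range (N + 2)) => le_boseDefect ht i
    have h3 : ∑ i ∈ range (N + 2), e i * w i
        = ∑ i ∈ range (N + 2), invMean (i + 1) * (bose t (i + 1) - bose t (i + 1 + 1))
          - bose t 1 * Real.eulerMascheroniSeq (N + 2) := by
      rw [← sum_invMean_mul, mul_sum, ← sum_sub_distrib]
      exact sum_congr rfl fun i _ => by simp only [he, hw]; ring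
    linarith
  have hlim := le_of_tendsto_of_tendsto'
    (((Real.tendsto_eulerMascheroniSeq.comp (tendsto_add_atTop_nat 2)).const_mul
      (bose t 1)).add_const ((e 0 - e 1) * w 0))
    ((tendsto_sum_boseDefect ht).comp (tendsto_add_atTop_nat 2)) hN
  linarith

lemma sum_boseDefect_le (ht : 0 < t) (N M : ℕ) :
    ∑ i ∈ range (N + M), boseDefect t i
      ≤ ∑ i ∈ range N, boseDefect t i + bose t (N + 1) - bose t ((N + M : ℕ) + 1) := by
  induction M with
  | zero => simp
  | succ M ih =>
    rw [← add_assoc, sum_range_succ]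
    have := boseDefect_lt ht (N + M)
    push_cast at *
    linarith

lemma tsum_bose_add_boseInt_le (ht : 0 < t) (N : ℕ) :
    ∑' n : ℕ, bose t (n + 1) + boseInt t 1
      ≤ ∑ i ∈ range N, boseDefect t i + bose t (N + 1) := by
  refine le_of_tendsto' ((tendsto_sum_boseDefect ht).comp (tendsto_add_atTop_nat N)) fun M => ?_
  simp only [Function.comp_apply, add_comm M N]
  have := bose_pos ht (by positivity : (0 : ℝ) < (N + M : ℕ) + 1)
  linarith [sum_boseDefect_le ht N M]

lemma tsum_bose_add_boseInt_lt (ht : 0 < t) :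
    ∑' n : ℕ, bose t (n + 1) + boseInt t 1 < bose t 1 := by
  -- N = 1 rather than 0: the strict bound on the first defect survives the limit.
  have h1 := tsum_bose_add_boseInt_le ht 1
  have h2 := boseDefect_lt ht 0
  simp at h1 h2
  linarith

/-! ### Sharpness: t → 0 and t → ∞. -/

lemma tendsto_exp_mul_sub_one_div (c : ℝ) :
    Tendsto (fun t : ℝ => (Real.exp (c * t) - 1) / t) (𝓝[>] 0) (𝓝 c) := by
  have h : HasDerivAt (fun t : ℝ => Real.exp (c * t)) c 0 := by
    have := ((hasDerivAt_id (0 : ℝ)).const_mul c).exp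
    exact this.congr_deriv (by simp)
  have h2 := (hasDerivAt_iff_tendsto_slope_zero.1 h).mono_left
    (nhdsWithin_mono 0 fun x (hx : 0 < x) => hx.ne')
  refine h2.congr fun t => ?_
  simp [div_eq_inv_mul]

lemma tendsto_bose_div {x : ℝ} (hx : 0 < x) :
    Tendsto (fun t => bose t x / bose t 1) (𝓝[>] 0) (𝓝 (1 / x)) := by
  refine ((tendsto_exp_mul_sub_one_div 1).div (tendsto_exp_mul_sub_one_div x) hx.ne').congr' ?_
  filter_upwards [self_mem_nhdsWithin] with t ht
  have ht : 0 < t := ht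
  have h1 := exp_sub_one_pos ht one_pos
  have h2 := exp_sub_one_pos ht hx
  simp only [Pi.div_apply, bose, mul_one, one_mul, mul_comm x t] at *
  field_simp

lemma tendsto_boseInt_sub_div {x : ℝ} (hx : 0 < x) :
    Tendsto (fun t => (boseInt t x - boseInt t 1) / bose t 1) (𝓝[>] 0) (𝓝 (Real.log x)) := by
  have h := (tendsto_exp_mul_sub_one_div (-x)).div (tendsto_exp_mul_sub_one_div (-1)) (by norm_num)
  have h2 := (tendsto_exp_mul_sub_one_div 1).mul (h.log (by simpa using hx.ne'))
  have e : 1 * Real.log (-x / -1) = Real.log x := by simp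
  rw [e] at h2
  refine h2.congr' ?_
  filter_upwards [self_mem_nhdsWithin] with t ht
  have ht : 0 < t := ht
  have hpos : ∀ y : ℝ, 0 < y → 0 < 1 - Real.exp (-(t * y)) := fun y hy =>
    sub_pos.2 (Real.exp_lt_one_iff.2 (neg_lt_zero.2 (mul_pos ht hy)))
  have h1 := hpos 1 one_pos
  have h3 := hpos x hx
  have e2 : (Real.exp (-x * t) - 1) / t / ((Real.exp (-1 * t) - 1) / t)
      = (1 - Real.exp (-(t * x))) / (1 - Real.exp (-(t * 1))) := by
    rw [div_div_div_cancel_right₀ ht.ne', ← neg_div_neg_eq]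
    ring_nf
  simp only [Pi.div_apply]
  rw [e2, Real.log_div h3.ne' h1.ne', boseInt, boseInt, bose]
  field_simp

lemma tendsto_sum_boseDefect_div (N : ℕ) :
    Tendsto (fun t => (∑ i ∈ range N, boseDefect t i + bose t (N + 1)) / bose t 1) (𝓝[>] 0)
      (𝓝 (Real.eulerMascheroniSeq N + 1 / (N + 1))) := by
  rw [eulerMascheroniSeq_eq_sum]
  have h := ((tendsto_finsetSum (range N) fun i _ =>
    tendsto_bose_div (by positivity : (0 : ℝ) < i + 1)).sub
      (tendsto_boseInt_sub_div (by positivity : (0 : ℝ) < N + 1))).add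
      (tendsto_bose_div (by positivity : (0 : ℝ) < N + 1))
  refine h.congr fun t => ?_
  rw [sum_boseDefect, ← sum_div, ← sub_div, ← add_div]

/-- Let t → 0 with N fixed, then N → ∞; no interchange of limit and series is needed. -/
lemma le_eulerMascheroniConstant_of_forall_le {a : ℝ}
    (h : ∀ t : ℝ, 0 < t → a ≤ (∑' n : ℕ, bose t (n + 1) + boseInt t 1) / bose t 1) :
    a ≤ Real.eulerMascheroniConstant := by
  have hN : ∀ N : ℕ, a ≤ Real.eulerMascheroniSeq N + 1 / (N + 1) := fun N => by
    refine ge_of_tendsto (tendsto_sum_boseDefect_div N) ?_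
    filter_upwards [self_mem_nhdsWithin] with t ht
    refine (h t ht).trans ?_
    have := bose_pos ht one_pos
    exact div_le_div_of_nonneg_right (tsum_bose_add_boseInt_le ht N) this.le
  have hlim := Real.tendsto_eulerMascheroniSeq.add
    (tendsto_one_div_add_atTop_nhds_zero_nat (𝕜 := ℝ))
  rw [add_zero] at hlim
  exact ge_of_tendsto' hlim hN

lemma one_sub_inv_lt_tsum_bose_div (ht : 0 < t) :
    1 - 1 / t < (∑' n : ℕ, bose t (n + 1) + boseInt t 1) / bose t 1 := by
  have hb := bose_pos ht one_pos
  rw [lt_div_iff₀ hb]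
  have h1 : bose t 1 < ∑' n : ℕ, bose t (n + 1) := by
    -- The second term makes the bound strict.
    have h := (summable_bose ht).sum_le_tsum (range 2)
      (fun i _ => (bose_pos ht (by positivity)).le)
    have := bose_pos ht (by norm_num : (0 : ℝ) < 1 + 1)
    simp [sum_range_succ] at h
    linarith
  have h2 : -(1 / t * bose t 1) ≤ boseInt t 1 := by
    have hq : 0 < 1 - Real.exp (-(t * 1)) :=
      sub_pos.2 (Real.exp_lt_one_iff.2 (neg_lt_zero.2 (mul_pos ht one_pos)))
    have h3 := Real.one_sub_inv_le_log_of_pos hq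
    have h4 := exp_sub_one_pos ht one_pos
    have e : 1 - (1 - Real.exp (-(t * 1)))⁻¹ = -bose t 1 := by
      have h5 : Real.exp (t * 1) * Real.exp (-(t * 1)) = 1 := by rw [← Real.exp_add]; simp
      have h6 : (1 - Real.exp (-(t * 1))) * (1 + bose t 1) = 1 := by
        rw [bose, one_add_div h4.ne', ← mul_div_assoc, div_eq_one_iff_eq h4.ne']
        linear_combination -h5
      rw [inv_eq_of_mul_eq_one_right h6]
      ring
    rw [e] at h3
    rw [boseInt, le_div_iff₀ ht]
    refine le_trans (le_of_eq ?_) h3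
    field_simp
  linarith

/-! ### Translation between divisor sums and the Bose function. -/

lemma bose_natCast (ht : 0 < t) {n : ℕ} (hn : 0 < n) :
    bose t n = Real.exp (-t) ^ n / (1 - Real.exp (-t) ^ n) := by
  have h0 := exp_sub_one_pos ht (Nat.cast_pos.2 hn)
  have h1 : Real.exp (-t) ^ n = (Real.exp (t * n))⁻¹ := by
    rw [← Real.exp_nat_mul, ← Real.exp_neg]; ring_nf
  rw [h1, bose]
  have h2 : 1 - (Real.exp (t * n))⁻¹ = (Real.exp (t * n) - 1) / Real.exp (t * n) := by
    field_simp
  rw [h2]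
  field_simp

lemma hasSum_numDiv_mul_pow (ht : 0 < t) :
    HasSum (fun k : ℕ => numDiv (k + 1) * Real.exp (-t) ^ (k + 1)) (∑' n : ℕ, bose t (n + 1)) := by
  have hq : ‖Real.exp (-t)‖ < 1 := by
    rw [Real.norm_of_nonneg (Real.exp_pos _).le, Real.exp_lt_one_iff]; linarith
  have hs : Summable (fun k : ℕ => numDiv (k + 1) * Real.exp (-t) ^ (k + 1)) := by
    have h := (summable_pow_mul_geometric_of_norm_lt_one 1 hq)
    rw [← summable_nat_add_iff 1] at h
    refine Summable.of_nonneg_of_le (fun k => by unfold numDiv; positivity) (fun k => ?_) h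
    have : numDiv (k + 1) ≤ (k + 1 : ℕ) := Nat.cast_le.2 (Nat.card_divisors_le_self (k + 1))
    rw [pow_one]
    gcongr
  rw [hs.hasSum_iff]
  have h := tsum_pow_div_one_sub_eq_tsum_sigma hq 0
  rw [tsum_pnat_eq_tsum_succ (f := fun n : ℕ =>
      (n : ℝ) ^ 0 * Real.exp (-t) ^ n / (1 - Real.exp (-t) ^ n)),
    tsum_pnat_eq_tsum_succ (f := fun n : ℕ =>
      (ArithmeticFunction.sigma 0 n : ℝ) * Real.exp (-t) ^ n)] at h
  simp only [ArithmeticFunction.sigma_zero_apply, pow_zero, one_mul] at h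
  simp only [numDiv]
  rw [← h]
  refine tsum_congr fun n => ?_
  rw [← bose_natCast ht n.succ_pos]
  simp

lemma hasSum_numDiv_sub_mul_pow (ht : 0 < t) :
    HasSum (fun k : ℕ => (numDiv (k + 2) - numDiv (k + 1)) * Real.exp (-t) ^ (k + 1))
      ((∑' n : ℕ, bose t (n + 1)) / bose t 1 - 1) := by
  have h := hasSum_numDiv_mul_pow ht
  have h2 := ((hasSum_nat_add_iff' 1).2 h).div_const (Real.exp (-t))
  have h3 := h2.sub h
  have hq := Real.exp_pos (-t)
  have hb : bose t 1 = Real.exp (-t) / (1 - Real.exp (-t)) := by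
    simpa using bose_natCast ht one_pos
  have hq1 : 0 < 1 - Real.exp (-t) := sub_pos.2 (Real.exp_lt_one_iff.2 (by linarith))
  have d1 : numDiv 1 = 1 := by simp [numDiv]
  have e : (∑' n : ℕ, bose t (n + 1)) / bose t 1 - 1
      = (∑' n : ℕ, bose t (n + 1) - ∑ i ∈ range 1, numDiv (i + 1) * Real.exp (-t) ^ (i + 1))
        / Real.exp (-t) - ∑' n : ℕ, bose t (n + 1) := by
    rw [hb, sum_range_one, zero_add, d1]
    field_simp
    ring
  rw [e]
  refine (congrArg (HasSum · _) (funext fun k => ?_)).mpr h3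
  rw [pow_succ _ (k + 1)]
  field_simp

lemma log_term_eq (ht : 0 < t) :
    (1 - Real.exp (-t)) * Real.log (1 - Real.exp (-t)) / (Real.exp (-t) * Real.log (Real.exp (-t)))
      = -(boseInt t 1 / bose t 1) := by
  have hq := Real.exp_pos (-t)
  have hb : bose t 1 = Real.exp (-t) / (1 - Real.exp (-t)) := by
    simpa using bose_natCast ht one_pos
  have hq1 : 0 < 1 - Real.exp (-t) := sub_pos.2 (Real.exp_lt_one_iff.2 (by linarith))
  rw [hb, boseInt, Real.log_exp, mul_one]
  field_simp

/-- The series over `k ≥ 1` is written with `k + 1` in place of `k`, for `k : ℕ`. -/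
theorem theorem4p2 :
    (∀ q : ℝ, 0 < q → q < 1 →
      Summable (fun k : ℕ => (numDiv (k + 2) - numDiv (k + 1)) * q ^ (k + 1)) ∧
      (Real.eulerMascheroniConstant - 1) + (1 - q) * Real.log (1 - q) / (q * Real.log q)
        < ∑' k : ℕ, (numDiv (k + 2) - numDiv (k + 1)) * q ^ (k + 1) ∧
      ∑' k : ℕ, (numDiv (k + 2) - numDiv (k + 1)) * q ^ (k + 1)
        < 0 + (1 - q) * Real.log (1 - q) / (q * Real.log q)) ∧
    (∀ α : ℝ,
      (∀ q : ℝ, 0 < q → q < 1 →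
        α + (1 - q) * Real.log (1 - q) / (q * Real.log q)
          < ∑' k : ℕ, (numDiv (k + 2) - numDiv (k + 1)) * q ^ (k + 1)) →
      α ≤ Real.eulerMascheroniConstant - 1) ∧
    (∀ β : ℝ,
      (∀ q : ℝ, 0 < q → q < 1 →
        ∑' k : ℕ, (numDiv (k + 2) - numDiv (k + 1)) * q ^ (k + 1)
          < β + (1 - q) * Real.log (1 - q) / (q * Real.log q)) →
      0 ≤ β) := by
  have hlt : ∀ t : ℝ, 0 < t → Real.exp (-t) < 1 := fun t ht =>
    Real.exp_lt_one_iff.2 (neg_lt_zero.2 ht)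
  refine ⟨fun q hq hq1 => ?_, fun α hα => ?_, fun β hβ => ?_⟩
  · obtain ⟨t, ht, rfl⟩ : ∃ t, 0 < t ∧ Real.exp (-t) = q :=
      ⟨-Real.log q, neg_pos.2 (Real.log_neg hq hq1), by rw [neg_neg, Real.exp_log hq]⟩
    have hb := bose_pos ht one_pos
    have h1 := (lt_div_iff₀ hb).2 (euler_mul_bose_lt ht)
    have h2 := (div_lt_one hb).2 (tsum_bose_add_boseInt_lt ht)
    rw [add_div] at h1 h2
    rw [(hasSum_numDiv_sub_mul_pow ht).tsum_eq, log_term_eq ht]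
    exact ⟨(hasSum_numDiv_sub_mul_pow ht).summable, by linarith, by linarith⟩
  · have := le_eulerMascheroniConstant_of_forall_le (a := α + 1) fun t ht => by
      have h := hα _ (Real.exp_pos (-t)) (hlt t ht)
      rw [(hasSum_numDiv_sub_mul_pow ht).tsum_eq, log_term_eq ht] at h
      rw [add_div]
      linarith
    linarith
  · by_contra! hneg
    -- With t = -1/β the lower bound 1 - 1/t equals 1 + β, the assumed upper bound.
    have ht : 0 < -(1 / β) := neg_pos.2 (one_div_neg.2 hneg)
    have h := hβ _ (Real.exp_pos _) (hlt _ ht)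
    rw [(hasSum_numDiv_sub_mul_pow ht).tsum_eq, log_term_eq ht] at h
    have h2 := one_sub_inv_lt_tsum_bose_div ht
    rw [add_div] at h2
    have e : 1 / (-(1 / β)) = -β := by field_simp
    linarith
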